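/- A Dyck path of semi-length $n$ is a lattice path with $n$ steps $U=(1,1)$ and $n$ steps $D=(1,-1)$ that starts at the origin, ends on the $x$-axis and never goes below the $x$-axis. A valley is a pair of consecutive steps $DU$, and its height is the $y$-coordinate of the point between the two steps. For an integer $d$, a Dyck path is called a $d$-Dyck path if, $\nu_1,\dots,\nu_k$ being the heights of its valleys from left to right, $\nu_{i+1}-\nu_i\ge d$ for all $1\le i<k$ (no condition if there is at most one valley). Let $r(n)$ be the number of $(-1)$-Dyck paths of semi-length $n$. Then $$r(n)\sim\frac{\rho^{-n}}{\sqrt{\pi n^3}}\cdot\frac{\sqrt{\rho\,(4-4\rho-4\rho^3)}}{4(-1+4\rho-2\rho^2)}\qquad(n\to\infty),$$ where $\rho$ is the smallest positive real root of $1-4x+2x^2+x^4$; this root exists and $|\rho-0.295598|<5\cdot 10^{-7}$. -/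

import Mathlib

open Filter Asymptotics

/-- The valley heights, from left to right, of a lattice path starting at height `h` whose steps
are listed in `l` (`U` raises the height by one, `D` lowers it by one): one entry for each
occurrence of two consecutive steps `D U`, namely the height of the point between them. -/
def valleyHeights : ℤ → List DyckStep → List ℤ
  | _, [] => []
  | h, DyckStep.U :: l => valleyHeights (h + 1) l
  | h, DyckStep.D :: l =>
      if l.head? = some DyckStep.U then (h - 1) :: valleyHeights (h - 1) l
      else valleyHeights (h - 1) l

/-- The valley vector `(ν₁, …, ν_k)` of a Dyck path. -/
def DyckWord.valleyVector (P : DyckWord) : List ℤ :=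
  valleyHeights 0 P.toList

/-- A Dyck path is (restricted) `d`-Dyck if `ν_{i+1} - ν_i ≥ d` for any two consecutive valleys;
for a path with at most one valley the condition is empty. -/
def DyckWord.IsRestricted (d : ℤ) (P : DyckWord) : Prop :=
  P.valleyVector.IsChain (fun a b => b - a ≥ d)

/-- `numRestricted d n` is the number of `d`-Dyck paths of semi-length `n`. -/
noncomputable def numRestricted (d : ℤ) (n : ℕ) : ℕ :=
  Nat.card {P : DyckWord // P.semilength = n ∧ P.IsRestricted d}

/-- There are only finitely many `d`-Dyck paths of semi-length `n`, so `numRestricted d n` is a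
genuine count. -/
theorem finite_restricted (d : ℤ) (n : ℕ) :
    Finite {P : DyckWord // P.semilength = n ∧ P.IsRestricted d} :=
  Finite.of_injective
    (fun P => (⟨P.1, P.2.1⟩ : {P : DyckWord // P.semilength = n}))
    (fun _ _ h => Subtype.ext (congrArg (fun Q => Q.1) h))

/-! A nonempty Dyck path is uniquely `U a D b`, that is, a binary tree with subtrees `a` and `b`.
Its valleys are those of `a` raised by one, followed, if `b` is nonempty, by a ground valley and
those of `b`. The path is (-1)-Dyck when both parts are and, for nonempty `b`, the last valley of
`a` (if any) is on the ground. With `V`, `L`, `R` counting valley-free paths, (-1)-Dyck paths with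
last valley on the ground, and all (-1)-Dyck paths, this gives V = 1 + XV, L = 1 + X(V + L(L - 1)),
R = 1 + X(R + L(R - 1)). Eliminating, 2(1 - 4X + 2X²)R = 1 - 4X + X² + N with N² = 1 - 4X + 2X² + X⁴
(`exists_sqrt_series`).

The asymptotics use real power series and dominated convergence instead of contour integrals. The
radicand factors as (1 - X/ρ)(1 - p), with p having nonnegative coefficients and p(1) = 1. The root
of the first factor is explicit through Catalan numbers (`exists_sqrt_one_sub_series`); that of the
second has bounded coefficients (`sqrt_series_bounds`), so it only multiplies the tail constant by
its value at ρ (`HasTail.mul`). It remains to divide by 1 - 4X + 2X² = (1 - lX)(1 - mX) with l, m =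
2 ± √2. Here 1/l ≈ 0.293 lies inside the disc of radius ρ, but the numerator vanishes there, so no
pole results (`HasTail.of_mul_linear`). The root 1/m lies outside and is harmless. -/

/-! ### Generating functions of weights on binary trees -/

open PowerSeries in
/-- The generating function, by number of nodes, of a weight on binary trees. -/
noncomputable def treeSeries (f : BinaryTree Unit → ℝ) : ℝ⟦X⟧ :=
  PowerSeries.mk fun n => ∑ t ∈ BinaryTree.treesOfNumNodesEq n, f t

open PowerSeries in
theorem coeff_treeSeries (f : BinaryTree Unit → ℝ) (n : ℕ) :
    coeff n (treeSeries f) = ∑ t ∈ BinaryTree.treesOfNumNodesEq n, f t := by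
  simp [treeSeries]

theorem sum_treesOfNumNodesEq_succ (f : BinaryTree Unit → ℝ) (n : ℕ) :
    ∑ t ∈ BinaryTree.treesOfNumNodesEq (n + 1), f t =
      ∑ ij ∈ Finset.HasAntidiagonal.antidiagonal n, ∑ a ∈ BinaryTree.treesOfNumNodesEq ij.1,
        ∑ b ∈ BinaryTree.treesOfNumNodesEq ij.2, f (BinaryTree.node () a b) := by
  rw [BinaryTree.treesOfNumNodesEq_succ, Finset.sum_biUnion]
  · refine Finset.sum_congr rfl fun ij _ => ?_
    rw [Finset.sum_map, Finset.sum_product]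
    rfl
  · simp_rw [Set.PairwiseDisjoint, Set.Pairwise, Finset.disjoint_left]
    aesop

-- Two products are allowed because node weights below split according to whether the right subtree
-- is empty.
open PowerSeries in
theorem treeSeries_eq (f g h g' h' : BinaryTree Unit → ℝ)
    (hf : ∀ a b, f (BinaryTree.node () a b) = g a * h b + g' a * h' b) :
    treeSeries f = C (f BinaryTree.nil) +
      X * (treeSeries g * treeSeries h + treeSeries g' * treeSeries h') := by
  ext n
  cases n with
  | zero => simp [coeff_treeSeries]
  | succ n =>
    rw [map_add, coeff_succ_X_mul, coeff_C, if_neg n.succ_ne_zero, zero_add, map_add, coeff_mul,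
      coeff_mul, coeff_treeSeries, sum_treesOfNumNodesEq_succ, ← Finset.sum_add_distrib]
    refine Finset.sum_congr rfl fun ij _ => ?_
    simp_rw [coeff_treeSeries, hf, Finset.sum_add_distrib, Finset.sum_mul_sum]

open PowerSeries in
theorem treeSeries_sub (f g : BinaryTree Unit → ℝ) :
    treeSeries (fun t => f t - g t) = treeSeries f - treeSeries g := by
  ext n
  simp [coeff_treeSeries]

open PowerSeries in
theorem treeSeries_nil : treeSeries (fun t => if t = BinaryTree.nil then 1 else 0) = 1 := by
  ext n
  rw [coeff_treeSeries, Finset.sum_ite_eq', coeff_one]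
  simp [eq_comm]

/-! ### Valleys under the first-return decomposition -/

theorem valleyHeights_add (l : List DyckStep) (h c : ℤ) :
    valleyHeights (h + c) l = (valleyHeights h l).map (· + c) := by
  induction l generalizing h with
  | nil => simp [valleyHeights]
  | cons s l ih =>
    cases s with
    | U => rw [valleyHeights, valleyHeights, ← ih]; congr 1; ring
    | D =>
      rw [valleyHeights, valleyHeights, show h + c - 1 = h - 1 + c by ring, ih]
      split_ifs <;> simp

/-- The condition on `l'` excludes a new valley at the junction. -/
theorem valleyHeights_append (l l' : List DyckStep) (h : ℤ) (hl' : l'.head? ≠ some DyckStep.U) :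
    valleyHeights h (l ++ l') = valleyHeights h l ++
      valleyHeights (h + l.count DyckStep.U - l.count DyckStep.D) l' := by
  induction l generalizing h with
  | nil => simp [valleyHeights]
  | cons s l ih =>
    cases s with
    | U =>
      rw [List.cons_append, valleyHeights, valleyHeights, ih]
      simp only [List.count_cons_self, List.count_cons_of_ne (show DyckStep.U ≠ DyckStep.D by decide)]
      congr 2; push_cast; ring
    | D =>
      rw [List.cons_append, valleyHeights, valleyHeights, ih]
      simp only [List.count_cons_self, List.count_cons_of_ne (show DyckStep.D ≠ DyckStep.U by decide)]
      have e : h - 1 + (l.count DyckStep.U : ℤ) - (l.count DyckStep.D : ℤ) =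
        h + (l.count DyckStep.U : ℤ) - ((l.count DyckStep.D + 1 : ℕ) : ℤ) := by push_cast; ring
      rw [e]
      cases l with
      | nil => simp [hl', valleyHeights]
      | cons a l =>
        rw [List.cons_append, List.head?_cons, List.head?_cons]
        by_cases ha : some a = some DyckStep.U
        · rw [if_pos ha, if_pos ha, List.cons_append]
        · rw [if_neg ha, if_neg ha]

theorem DyckWord.valleyVector_nest_add (P Q : DyckWord) :
    (P.nest + Q).valleyVector =
      P.valleyVector.map (· + 1) ++ if Q = 0 then [] else 0 :: Q.valleyVector := by
  have e : (P.nest + Q).toList = DyckStep.U :: (P.toList ++ DyckStep.D :: Q.toList) := by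
    change (([DyckStep.U] ++ P.toList ++ [DyckStep.D]) ++ Q.toList) = _
    simp
  rw [valleyVector, e, valleyHeights, valleyHeights_append _ _ _ (by simp), valleyHeights_add,
    P.count_U_eq_count_D, valleyHeights]
  simp only [valleyVector]
  by_cases hQ : Q = 0
  · subst hQ
    simp [show (0 : DyckWord).toList = [] from rfl, valleyHeights]
  · have hne := DyckWord.toList_ne_nil.2 hQ
    have := Q.head_eq_U hne
    rw [List.head?_eq_some_head hne, this]
    simp [hQ]

/-- The valley heights of the Dyck path corresponding to a binary tree. -/
def BinaryTree.valleys : BinaryTree Unit → List ℤ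
  | .nil => []
  | .node _ a b => a.valleys.map (· + 1) ++ if b = .nil then [] else 0 :: b.valleys

theorem DyckWord.ofTree_eq_zero {t : BinaryTree Unit} : ofTree t = 0 ↔ t = .nil := by
  constructor
  · intro h
    rw [← toTree_ofTree t, h, toTree, if_pos rfl]
  · rintro rfl; rfl

theorem DyckWord.valleyVector_ofTree (t : BinaryTree Unit) :
    (ofTree t).valleyVector = t.valleys := by
  induction t with
  | nil => rfl
  | node _ a b iha ihb =>
    rw [ofTree, valleyVector_nest_add, iha, ihb, BinaryTree.valleys]
    simp only [ofTree_eq_zero]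

theorem BinaryTree.valleys_nonneg (t : BinaryTree Unit) : ∀ x ∈ t.valleys, 0 ≤ x := by
  induction t with
  | nil => simp [valleys]
  | node _ a b iha ihb =>
    intro x hx
    rw [valleys, List.mem_append, List.mem_map] at hx
    rcases hx with ⟨y, hy, rfl⟩ | hx
    · linarith [iha y hy]
    · split_ifs at hx
      · simp at hx
      · rcases List.mem_cons.1 hx with rfl | hx
        · rfl
        · exact ihb x hx

/-! ### Recursive description of (-1)-Dyck paths -/

/-- The tree encodes a `(-1)`-Dyck path. -/
def BinaryTree.Slow (t : BinaryTree Unit) : Prop :=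
  t.valleys.IsChain (fun a b => b - a ≥ (-1 : ℤ))

/-- The tree encodes a `(-1)`-Dyck path whose last valley, if there is one, has height zero. -/
def BinaryTree.SlowGround (t : BinaryTree Unit) : Prop :=
  t.Slow ∧ ∀ x ∈ t.valleys.getLast?, x = 0

theorem BinaryTree.isChain_map_add_one (l : List ℤ) :
    (l.map (· + 1)).IsChain (fun a b => b - a ≥ (-1 : ℤ)) ↔
      l.IsChain (fun a b => b - a ≥ (-1 : ℤ)) := by
  rw [List.isChain_map]
  simp

theorem BinaryTree.valleys_node_eq_nil {a b : BinaryTree Unit} :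
    (node () a b).valleys = [] ↔ a.valleys = [] ∧ b = nil := by
  rw [valleys]
  split_ifs with h <;> simp [h]

/-- If `b` is nonempty, the last valley of `a`, at height x + 1 after raising, is followed by one at
height 0; a drop of at most 1 together with x ≥ 0 forces x = 0. The step from 0 into the valleys of
`b` is free, as these are nonnegative. -/
theorem BinaryTree.slow_node {a b : BinaryTree Unit} :
    (node () a b).Slow ↔ (a.Slow ∧ b = nil) ∨ (a.SlowGround ∧ b ≠ nil ∧ b.Slow) := by
  rw [Slow, valleys]
  split_ifs with h
  · rw [List.append_nil, isChain_map_add_one]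
    simp [h, Slow]
  · simp only [h, and_false, ne_eq, not_false_eq_true, true_and, false_or]
    rw [List.isChain_append, isChain_map_add_one, List.isChain_cons, SlowGround]
    constructor
    · rintro ⟨h1, ⟨-, h2⟩, h3⟩
      refine ⟨⟨h1, fun x hx => ?_⟩, h2⟩
      have := h3 (x + 1) (by rw [List.getLast?_map]; simp_all) 0 (by simp)
      have := a.valleys_nonneg x (List.mem_of_getLast? hx)
      linarith
    · rintro ⟨⟨h1, h2⟩, h3⟩
      refine ⟨h1, ⟨fun y hy => ?_, h3⟩, fun x hx y hy => ?_⟩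
      · have := b.valleys_nonneg y (List.mem_of_head? hy)
        linarith
      · rw [List.getLast?_map, Option.mem_map] at hx
        obtain ⟨z, hz, rfl⟩ := hx
        simp only [List.head?_cons, Option.mem_some_iff] at hy
        rw [h2 z hz, ← hy]
        norm_num

/-- With `b` empty, every valley is a raised one, hence positive, so there can be none. -/
theorem BinaryTree.slowGround_node {a b : BinaryTree Unit} :
    (node () a b).SlowGround ↔
      (a.valleys = [] ∧ b = nil) ∨ (a.SlowGround ∧ b ≠ nil ∧ b.SlowGround) := by
  rw [SlowGround, slow_node]
  by_cases h : b = nil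
  · simp only [h, and_true, ne_eq, not_true_eq_false, false_and, and_false, or_false]
    rw [valleys]
    simp only [if_true, List.append_nil]
    constructor
    · rintro ⟨-, h2⟩
      by_contra hne
      have hx := List.getLast?_eq_getLast_of_ne_nil hne
      have := h2 (a.valleys.getLast hne + 1) (by rw [List.getLast?_map, hx]; rfl)
      have := a.valleys_nonneg _ (List.getLast_mem hne)
      linarith
    · intro ha
      simp [ha, Slow]
  · simp only [h, and_false, ne_eq, not_false_eq_true, true_and, false_or]
    rw [valleys, if_neg h, SlowGround, SlowGround, and_assoc]
    refine and_congr_right fun _ => and_congr_right fun _ => ?_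
    rw [List.getLast?_append_of_ne_nil _ (by simp), List.getLast?_cons]
    cases b.valleys.getLast? <;> simp

/-! ### Functional equations and their solution -/

open Classical in
/-- The real-valued indicator of a set of trees. -/
noncomputable def BinaryTree.ind (p : BinaryTree Unit → Prop) (t : BinaryTree Unit) : ℝ :=
  if p t then 1 else 0

open BinaryTree in
theorem treeSeries_ind_eq (p q r q' r' : BinaryTree Unit → Prop) (h0 : p nil)
    (h : ∀ a b, p (node () a b) ↔ (q a ∧ b = nil ∧ r b) ∨ (q' a ∧ b ≠ nil ∧ r' b))
    (hr : r nil) (hr' : r' nil) :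
    treeSeries (ind p) = 1 + PowerSeries.X * (treeSeries (ind q) +
      treeSeries (ind q') * (treeSeries (ind r') - 1)) := by
  have := treeSeries_eq (ind p) (ind q) (fun t => if t = nil then 1 else 0) (ind q')
    (fun t => ind r' t - if t = nil then 1 else 0) (fun a b => by
      classical
      unfold ind
      simp only [h a b]
      by_cases hb : b = nil
      · subst hb; simp [hr, hr']
      · simp only [hb, and_false, false_and, false_or, ne_eq, not_false_eq_true, true_and]
        by_cases h1 : q' a <;> simp [h1])
  rw [this, treeSeries_sub, treeSeries_nil, mul_one]
  simp [ind, h0]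

theorem numRestricted_eq_coeff (n : ℕ) :
    (numRestricted (-1) n : ℝ) =
      PowerSeries.coeff n (treeSeries (BinaryTree.ind BinaryTree.Slow)) := by
  classical
  rw [coeff_treeSeries]
  simp only [BinaryTree.ind]
  rw [Finset.sum_boole, numRestricted, ← Nat.card_eq_finsetCard]
  congr 1
  refine Nat.card_congr (DyckWord.equivTree.subtypeEquiv fun P => ?_)
  have e : P.valleyVector = P.toTree.valleys := by
    rw [← DyckWord.valleyVector_ofTree, DyckWord.ofTree_toTree]
  simp [DyckWord.IsRestricted, BinaryTree.Slow, e]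

/-- The series `1 - 4X + 2X² + X⁴` has a square root with constant term one, in terms of which
the number of `(-1)`-Dyck paths can be expressed. -/
theorem exists_sqrt_series : ∃ N : PowerSeries ℝ,
    PowerSeries.coeff 0 N = 1 ∧
    N ^ 2 = 1 - 4 * PowerSeries.X + 2 * PowerSeries.X ^ 2 + PowerSeries.X ^ 4 ∧
    2 * (1 - 4 * PowerSeries.X + 2 * PowerSeries.X ^ 2) *
      (PowerSeries.mk fun n => (numRestricted (-1) n : ℝ)) =
      1 - 4 * PowerSeries.X + PowerSeries.X ^ 2 + N := by
  set V := treeSeries (BinaryTree.ind fun t => t.valleys = []) with hV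
  set L := treeSeries (BinaryTree.ind BinaryTree.SlowGround) with hL
  set R := treeSeries (BinaryTree.ind BinaryTree.Slow) with hR
  have eR : (PowerSeries.mk fun n => (numRestricted (-1) n : ℝ)) = R := by
    ext n
    rw [PowerSeries.coeff_mk, numRestricted_eq_coeff]
  have slow_nil : BinaryTree.nil.Slow := by simp [BinaryTree.Slow, BinaryTree.valleys]
  have ground_nil : BinaryTree.nil.SlowGround :=
    ⟨slow_nil, by simp [BinaryTree.valleys]⟩
  have hV1 : V = 1 + PowerSeries.X * V := by
    have := treeSeries_eq (BinaryTree.ind fun t => t.valleys = [])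
      (BinaryTree.ind fun t => t.valleys = []) (fun t => if t = .nil then 1 else 0)
      (fun _ => 0) (fun _ => 0) (fun a b => by
        unfold BinaryTree.ind
        by_cases h1 : a.valleys = [] <;> simp [BinaryTree.valleys_node_eq_nil, h1])
    have z : treeSeries (fun _ => 0) = 0 := by ext n; simp [coeff_treeSeries]
    rw [treeSeries_nil, mul_one, z, mul_zero, add_zero] at this
    rw [← hV] at this
    nth_rw 1 [this]
    simp [BinaryTree.ind, BinaryTree.valleys]
  have hL1 : L = 1 + PowerSeries.X * (V + L * (L - 1)) :=
    treeSeries_ind_eq _ _ (fun _ => True) _ _ ground_nil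
      (fun a b => by rw [BinaryTree.slowGround_node]; simp) trivial ground_nil
  have hR1 : R = 1 + PowerSeries.X * (R + L * (R - 1)) :=
    treeSeries_ind_eq _ _ (fun _ => True) _ _ slow_nil
      (fun a b => by rw [BinaryTree.slow_node]; simp) trivial slow_nil
  -- `hL1` is the quadratic XL² - (1 + X)L + 1 + XV = 0, so 1 + X - 2XL is a square root of its
  -- discriminant; the factor 1 - X clears the denominator of V = 1/(1 - X).
  refine ⟨(1 - PowerSeries.X) * (1 + PowerSeries.X - 2 * PowerSeries.X * L), ?_, ?_, ?_⟩
  · simp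
  · linear_combination (-4 * PowerSeries.X * (1 - PowerSeries.X) ^ 2) * hL1
      - 4 * PowerSeries.X ^ 2 * (1 - PowerSeries.X) * hV1
  · rw [eR]
    -- `hR1` says (1 - X - XL)R = 1 - XL, so R is determined after cancelling this factor.
    have h1 : (1 - PowerSeries.X - PowerSeries.X * L) ≠ 0 := by
      intro h
      have := congrArg (PowerSeries.coeff 0) h
      simp at this
    refine mul_left_cancel₀ h1 ?_
    linear_combination (2 * (1 - 4 * PowerSeries.X + 2 * PowerSeries.X ^ 2)) * hR1 +
      2 * PowerSeries.X * (1 - PowerSeries.X) * hL1 + 2 * PowerSeries.X ^ 2 * hV1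

/-! ### Evaluating real power series -/

open PowerSeries Topology

/-- The power series `f` converges absolutely at `x`, with sum `y`. -/
def EvalsTo (f : ℝ⟦X⟧) (x y : ℝ) : Prop :=
  Summable (fun n => ‖coeff n f * x ^ n‖) ∧ HasSum (fun n => coeff n f * x ^ n) y

namespace EvalsTo

variable {f g : ℝ⟦X⟧} {x y z : ℝ}

theorem add (hf : EvalsTo f x y) (hg : EvalsTo g x z) : EvalsTo (f + g) x (y + z) := by
  have e : (fun n => coeff n (f + g) * x ^ n) =
      fun n => coeff n f * x ^ n + coeff n g * x ^ n := by ext n; simp [add_mul]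
  refine ⟨?_, e ▸ hf.2.add hg.2⟩
  refine (hf.1.add hg.1).of_nonneg_of_le (fun n => norm_nonneg _) fun n => ?_
  rw [congrFun e n]
  exact norm_add_le _ _

theorem mul (hf : EvalsTo f x y) (hg : EvalsTo g x z) : EvalsTo (f * g) x (y * z) := by
  have e : ∀ n, coeff n (f * g) * x ^ n =
      ∑ kl ∈ Finset.HasAntidiagonal.antidiagonal n,
        (coeff kl.1 f * x ^ kl.1) * (coeff kl.2 g * x ^ kl.2) := by
    intro n
    rw [coeff_mul, Finset.sum_mul]
    refine Finset.sum_congr rfl fun kl hkl => ?_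
    rw [← Finset.HasAntidiagonal.mem_antidiagonal.1 hkl, pow_add]
    ring
  have hs : Summable fun n => ‖coeff n (f * g) * x ^ n‖ := by
    have := summable_norm_sum_mul_antidiagonal_of_summable_norm hf.1 hg.1
    exact this.congr fun n => by rw [e]
  refine ⟨hs, ?_⟩
  have := tsum_mul_tsum_eq_tsum_sum_antidiagonal_of_summable_norm hf.1 hg.1
  rw [hf.2.tsum_eq, hg.2.tsum_eq, ← tsum_congr e] at this
  rw [this]
  exact hs.of_norm.hasSum

theorem unique (hf : EvalsTo f x y) (hf' : EvalsTo f x z) : y = z := hf.2.unique hf'.2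

theorem const (a : ℝ) : EvalsTo (C a) x a := by
  have h : ∀ n, n ≠ 0 → coeff n (C a) * x ^ n = 0 := fun n hn => by simp [coeff_C, hn]
  refine ⟨?_, ?_⟩
  · refine summable_of_ne_finset_zero (s := {0}) fun n hn => ?_
    rw [h n (by simpa using hn), norm_zero]
  · convert hasSum_single 0 h using 1
    simp

theorem var : EvalsTo X x x := by
  have h : ∀ n, n ≠ 1 → coeff n X * x ^ n = 0 := fun n hn => by simp [coeff_X, hn]
  refine ⟨?_, ?_⟩
  · refine summable_of_ne_finset_zero (s := {1}) fun n hn => ?_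
    rw [h n (by simpa using hn), norm_zero]
  · convert hasSum_single 1 h using 1
    simp

theorem one : EvalsTo (1 : ℝ⟦X⟧) x 1 := by
  simpa using const (x := x) 1

theorem neg (hf : EvalsTo f x y) : EvalsTo (-f) x (-y) := by
  simpa using (const (x := x) (-1)).mul hf

theorem sub (hf : EvalsTo f x y) (hg : EvalsTo g x z) : EvalsTo (f - g) x (y - z) := by
  simpa [sub_eq_add_neg] using hf.add hg.neg

theorem pow (hf : EvalsTo f x y) (n : ℕ) : EvalsTo (f ^ n) x (y ^ n) := by
  induction n with
  | zero => simpa using one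
  | succ n ih => simpa [pow_succ] using ih.mul hf

end EvalsTo

/-! ### Square roots of power series -/

/-- A power series `f` with `f² = 1 - p` and constant term one, where `p` has nonnegative
coefficients and `p(r) ≤ 1`, is of the form `1 - t` where `t` has nonnegative coefficients
and `t(r) ≤ 1`. -/
theorem sqrt_series_bounds {f p : ℝ⟦X⟧} {r : ℝ} (hr : 0 ≤ r) (hf : f ^ 2 = 1 - p)
    (hf0 : coeff 0 f = 1) (hp : ∀ n, 0 ≤ coeff n p)
    (hp1 : ∀ n, ∑ k ∈ Finset.range n, coeff k p * r ^ k ≤ 1) :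
    (∀ n, 0 ≤ coeff n (1 - f)) ∧
      ∀ n, ∑ k ∈ Finset.range n, coeff k (1 - f) * r ^ k ≤ 1 := by
  set t := 1 - f with ht
  have t0 : coeff 0 t = 0 := by rw [ht, map_sub, hf0]; simp
  have ht2 : 2 * t = p + t * t := by rw [ht]; linear_combination -hf
  -- Since t has zero constant term, 2t = p + t² is a recursion with nonnegative terms that
  -- expresses each coefficient of t through earlier ones.
  have hc : ∀ n, 2 * coeff n t = coeff n p +
      ∑ kl ∈ Finset.HasAntidiagonal.antidiagonal n, coeff kl.1 t * coeff kl.2 t := fun n => by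
    rw [← coeff_mul, ← map_add, ← ht2, two_mul, two_mul, map_add]
  have hpos : ∀ n, 0 ≤ coeff n t := by
    intro n
    induction n using Nat.strong_induction_on with
    | _ n ih =>
      rcases Nat.eq_zero_or_pos n with rfl | hn
      · exact t0.ge
      have : 0 ≤ ∑ kl ∈ Finset.HasAntidiagonal.antidiagonal n, coeff kl.1 t * coeff kl.2 t := by
        refine Finset.sum_nonneg fun kl hkl => ?_
        have := Finset.HasAntidiagonal.mem_antidiagonal.1 hkl
        rcases Nat.eq_zero_or_pos kl.1 with h1 | h1
        · rw [h1, t0, zero_mul]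
        rcases Nat.eq_zero_or_pos kl.2 with h2 | h2
        · rw [h2, t0, mul_zero]
        exact mul_nonneg (ih _ (by omega)) (ih _ (by omega))
      linarith [hc n, hp n]
  refine ⟨hpos, fun n => ?_⟩
  induction n with
  | zero => simp
  | succ n ih =>
    set T := ∑ k ∈ Finset.range n, coeff k t * r ^ k with hT
    have hT0 : 0 ≤ T := Finset.sum_nonneg fun k _ => mul_nonneg (hpos k) (pow_nonneg hr k)
    -- Nonzero terms have both indices positive with sum at most n, hence both below n, so they all
    -- occur in T². Then twice the next partial sum is at most 1 + T² ≤ 2.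
    have key : ∑ m ∈ Finset.range (n + 1),
        (∑ kl ∈ Finset.HasAntidiagonal.antidiagonal m, coeff kl.1 t * coeff kl.2 t) * r ^ m ≤
          T * T := by
      have e : ∀ m, (∑ kl ∈ Finset.HasAntidiagonal.antidiagonal m,
          coeff kl.1 t * coeff kl.2 t) * r ^ m =
          ∑ kl ∈ Finset.HasAntidiagonal.antidiagonal m,
            (coeff kl.1 t * r ^ kl.1) * (coeff kl.2 t * r ^ kl.2) := fun m => by
        rw [Finset.sum_mul]
        refine Finset.sum_congr rfl fun kl hkl => ?_
        rw [← Finset.HasAntidiagonal.mem_antidiagonal.1 hkl, pow_add]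
        ring
      have hz : ∀ k, 0 ≤ coeff k t * r ^ k := fun k => mul_nonneg (hpos k) (pow_nonneg hr k)
      have hi : ∀ m ∈ Finset.range (n + 1), ∑ kl ∈ Finset.HasAntidiagonal.antidiagonal m,
            (coeff kl.1 t * r ^ kl.1) * (coeff kl.2 t * r ^ kl.2) =
          ∑ kl ∈ (Finset.range n ×ˢ Finset.range n).filter (fun kl => kl.1 + kl.2 = m),
            (coeff kl.1 t * r ^ kl.1) * (coeff kl.2 t * r ^ kl.2) := fun m hm => by
        refine (Finset.sum_subset (fun kl hkl => ?_) fun kl hkl hkl' => ?_).symm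
        · exact Finset.HasAntidiagonal.mem_antidiagonal.2 (Finset.mem_filter.1 hkl).2
        · have h1 := Finset.HasAntidiagonal.mem_antidiagonal.1 hkl
          have hm := Finset.mem_range.1 hm
          simp only [Finset.mem_filter, Finset.mem_product, Finset.mem_range, not_and] at hkl'
          have : kl.1 = 0 ∨ kl.2 = 0 := by
            by_contra hne
            exact hkl' (by omega) h1
          rcases this with h | h <;> simp [h, t0]
      rw [Finset.sum_congr rfl fun m hm => (e m).trans (hi m hm), hT, Finset.sum_mul_sum, ← Finset.sum_product']
      exact Finset.sum_fiberwise_le_sum_of_sum_fiber_nonneg fun m _ =>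
        Finset.sum_nonneg fun kl _ => mul_nonneg (hz _) (hz _)
    have h2 : 2 * ∑ k ∈ Finset.range (n + 1), coeff k t * r ^ k =
        ∑ k ∈ Finset.range (n + 1), coeff k p * r ^ k + ∑ m ∈ Finset.range (n + 1),
        (∑ kl ∈ Finset.HasAntidiagonal.antidiagonal m, coeff kl.1 t * coeff kl.2 t) * r ^ m := by
      rw [Finset.mul_sum, ← Finset.sum_add_distrib]
      refine Finset.sum_congr rfl fun k _ => ?_
      rw [← mul_assoc, hc]
      ring
    nlinarith [hp1 (n + 1)]

/-- Under the hypotheses of `sqrt_series_bounds`, the series takes the value `√(1 - p(x))` for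
`0 ≤ x ≤ r`. -/
theorem sqrt_series_evalsTo {f p : ℝ⟦X⟧} {r x y : ℝ} (hr : 0 ≤ r) (hf : f ^ 2 = 1 - p)
    (hf0 : coeff 0 f = 1) (hp : ∀ n, 0 ≤ coeff n p)
    (hp1 : ∀ n, ∑ k ∈ Finset.range n, coeff k p * r ^ k ≤ 1) (hx : 0 ≤ x) (hxr : x ≤ r)
    (hy : EvalsTo (1 - p) x y) : EvalsTo f x (√y) := by
  obtain ⟨hpos, hsum⟩ := sqrt_series_bounds hr hf hf0 hp hp1
  have h0 : ∀ n, 0 ≤ coeff n (1 - f) * x ^ n := fun n => mul_nonneg (hpos n) (pow_nonneg hx n)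
  have hle : ∀ n, ∑ k ∈ Finset.range n, coeff k (1 - f) * x ^ k ≤ 1 := fun n =>
    (Finset.sum_le_sum fun k _ => by gcongr; exact hpos k).trans (hsum n)
  have hs : Summable fun n => coeff n (1 - f) * x ^ n := summable_of_sum_range_le h0 hle
  have ht : EvalsTo (1 - f) x (∑' n, coeff n (1 - f) * x ^ n) := ⟨hs.norm, hs.hasSum⟩
  have hT : ∑' n, coeff n (1 - f) * x ^ n ≤ 1 := Real.tsum_le_of_sum_range_le h0 hle
  have hF : EvalsTo f x (1 - ∑' n, coeff n (1 - f) * x ^ n) := by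
    simpa using EvalsTo.one.sub ht
  have h2 := (hF.pow 2).unique (hf ▸ hy)
  -- The bound t(x) ≤ 1 selects the nonnegative square root.
  rw [← h2, Real.sqrt_sq (by linarith)]
  exact hF

/-! ### Coefficient tails of order ρ⁻ⁿ n^(-3/2) -/

/-- The coefficients of `f` satisfy `[Xⁿ] f ∼ c ρ⁻ⁿ n^(-3/2)` (with `c = 0` allowed). -/
def HasTail (f : ℝ⟦X⟧) (ρ c : ℝ) : Prop :=
  Tendsto (fun n : ℕ => coeff n f * ρ ^ n * √((n : ℝ) ^ 3)) atTop (𝓝 c)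

theorem tendsto_sqrt_cube_div (k : ℕ) :
    Tendsto (fun n : ℕ => √((n : ℝ) ^ 3) / √(((n + k : ℕ) : ℝ) ^ 3)) atTop (𝓝 1) := by
  have h := ((tendsto_natCast_div_add_atTop (𝕜 := ℝ) (k : ℝ)).pow 3).sqrt
  rw [one_pow, Real.sqrt_one] at h
  refine h.congr fun n => ?_
  rw [← Real.sqrt_div (by positivity), div_pow]
  push_cast
  rfl

theorem HasTail.exists_bound {f : ℝ⟦X⟧} {ρ c : ℝ} (hf : HasTail f ρ c) :
    ∃ D, 0 ≤ D ∧ ∀ n : ℕ, ‖coeff n f * ρ ^ n * √((n : ℝ) ^ 3)‖ ≤ D := by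
  obtain ⟨D, hD⟩ := (Filter.Tendsto.norm hf).bddAbove_range
  have hD' : ∀ n : ℕ, ‖coeff n f * ρ ^ n * √((n : ℝ) ^ 3)‖ ≤ D := fun n => hD ⟨n, rfl⟩
  exact ⟨D, (norm_nonneg _).trans (hD' 0), hD'⟩

/-- The weight at n + 1 is positive even for n = 0, so the bound also controls the constant
coefficient. -/
theorem HasTail.exists_bound_succ {f : ℝ⟦X⟧} {ρ c : ℝ} (hf : HasTail f ρ c) :
    ∃ D, 0 ≤ D ∧ ∀ n : ℕ, ‖coeff n f * ρ ^ n‖ * √(((n + 1 : ℕ) : ℝ) ^ 3) ≤ D := by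
  have h : Tendsto (fun n : ℕ => coeff n f * ρ ^ n * √(((n + 1 : ℕ) : ℝ) ^ 3)) atTop (𝓝 c) := by
    have := Filter.Tendsto.div hf (tendsto_sqrt_cube_div 1) one_ne_zero
    rw [div_one] at this
    refine this.congr' ?_
    filter_upwards [eventually_gt_atTop 0] with n hn
    have : √((n : ℝ) ^ 3) ≠ 0 := by positivity
    rw [Pi.div_apply]
    field_simp
  obtain ⟨D, hD⟩ := h.norm.bddAbove_range
  have hD' : ∀ n : ℕ, ‖coeff n f * ρ ^ n‖ * √(((n + 1 : ℕ) : ℝ) ^ 3) ≤ D := fun n => by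
    have : ‖coeff n f * ρ ^ n * √(((n + 1 : ℕ) : ℝ) ^ 3)‖ ≤ D := hD ⟨n, rfl⟩
    rwa [norm_mul, Real.norm_of_nonneg (Real.sqrt_nonneg _)] at this
  exact ⟨D, (mul_nonneg (norm_nonneg _) (Real.sqrt_nonneg _)).trans (hD' 0), hD'⟩

theorem summable_geometric_mul_sqrt_cube {q : ℝ} (hq0 : 0 ≤ q) (hq1 : q < 1) :
    Summable fun k : ℕ => q ^ k * √(((k + 1 : ℕ) : ℝ) ^ 3) := by
  have hq : ‖q‖ < 1 := by rwa [Real.norm_of_nonneg hq0]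
  have h := ((summable_pow_mul_geometric_of_norm_lt_one 2 hq).add
    (summable_geometric_of_norm_lt_one hq)).mul_left 2
  refine h.of_nonneg_of_le (fun k => by positivity) fun k => ?_
  have h1 : √(((k + 1 : ℕ) : ℝ) ^ 3) ≤ ((k : ℝ) + 1) ^ 2 := by
    rw [Real.sqrt_le_left (by positivity), ← pow_mul]
    push_cast
    exact pow_le_pow_right₀ (by linarith [(Nat.cast_nonneg k : (0 : ℝ) ≤ k)]) (by norm_num)
  have h2 : ((k : ℝ) + 1) ^ 2 ≤ 2 * ((k : ℝ) ^ 2 + 1) := by nlinarith [sq_nonneg ((k : ℝ) - 1)]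
  calc q ^ k * √(((k + 1 : ℕ) : ℝ) ^ 3) ≤ q ^ k * (2 * ((k : ℝ) ^ 2 + 1)) := by
        gcongr; exact h1.trans h2
    _ = _ := by ring

/-- Multiplication by a series of larger radius of convergence multiplies the tail constant by
the value of that series. -/
theorem HasTail.mul {f g : ℝ⟦X⟧} {ρ c K q y : ℝ} (hf : HasTail f ρ c) (hq0 : 0 ≤ q) (hq1 : q < 1)
    (hg : ∀ n, ‖coeff n g * ρ ^ n‖ ≤ K * q ^ n) (hy : EvalsTo g ρ y) :
    HasTail (f * g) ρ (c * y) := by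
  obtain ⟨D, hD0, hD⟩ := hf.exists_bound_succ
  -- The Cauchy product, extended by zero to all k; for fixed k the term tends to c times the k-th
  -- term of g(ρ).
  let F : ℕ → ℕ → ℝ := fun n k => if k ≤ n then
    (coeff k g * ρ ^ k) * (coeff (n - k) f * ρ ^ (n - k)) * √((n : ℝ) ^ 3) else 0
  have hF : ∀ n, coeff n (f * g) * ρ ^ n * √((n : ℝ) ^ 3) = ∑' k, F n k := fun n => by
    rw [tsum_eq_sum (s := Finset.range (n + 1)), mul_comm f g, coeff_mul,
      Finset.Nat.sum_antidiagonal_eq_sum_range_succ (fun i j => coeff i g * coeff j f) n,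
      Finset.sum_mul, Finset.sum_mul]
    · refine Finset.sum_congr rfl fun k hk => ?_
      have hk : k ≤ n := Nat.lt_succ_iff.1 (Finset.mem_range.1 hk)
      simp only [F, if_pos hk]
      rw [← pow_sub_mul_pow ρ hk]
      ring
    · intro k hk
      exact if_neg fun h => hk (Finset.mem_range.2 (Nat.lt_succ_iff.2 h))
  have hK : 0 ≤ K := by simpa using (norm_nonneg _).trans (hg 0)
  unfold HasTail
  simp_rw [hF]
  rw [mul_comm c y, ← hy.2.tsum_eq, ← tsum_mul_right]
  refine tendsto_tsum_of_dominated_convergence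
    (bound := fun k => K * D * (q ^ k * √(((k + 1 : ℕ) : ℝ) ^ 3)))
    ((summable_geometric_mul_sqrt_cube hq0 hq1).mul_left _) (fun k => ?_)
    (Eventually.of_forall fun n k => ?_)
  · rw [← tendsto_add_atTop_iff_nat k]
    have h := (Filter.Tendsto.div hf (tendsto_sqrt_cube_div k) one_ne_zero).const_mul
      (coeff k g * ρ ^ k)
    rw [div_one] at h
    refine h.congr' ?_
    filter_upwards [eventually_gt_atTop 0] with n hn
    have h1 : √((n : ℝ) ^ 3) ≠ 0 := by positivity
    have h2 : √(((n + k : ℕ) : ℝ) ^ 3) ≠ 0 := by positivity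
    simp only [F, if_pos (Nat.le_add_left k n), Nat.add_sub_cancel, Pi.div_apply]
    field_simp
  · simp only [F]
    split_ifs with hk
    · rw [norm_mul, norm_mul, Real.norm_of_nonneg (Real.sqrt_nonneg _)]
      -- From n ≤ (n - k + 1)(k + 1): one factor is absorbed by the tail bound on f, the other by
      -- the geometric decay of g.
      have h1 : √((n : ℝ) ^ 3) ≤ √(((n - k + 1 : ℕ) : ℝ) ^ 3) * √(((k + 1 : ℕ) : ℝ) ^ 3) := by
        rw [← Real.sqrt_mul (by positivity), ← mul_pow]
        gcongr
        obtain ⟨m, rfl⟩ := Nat.exists_eq_add_of_le hk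
        rw [Nat.add_sub_cancel_left]
        exact_mod_cast (by nlinarith [Nat.zero_le (m * k)] : k + m ≤ (m + 1) * (k + 1))
      calc _ ≤ (K * q ^ k) * ‖coeff (n - k) f * ρ ^ (n - k)‖ *
            (√(((n - k + 1 : ℕ) : ℝ) ^ 3) * √(((k + 1 : ℕ) : ℝ) ^ 3)) := by
            gcongr; exact hg k
        _ = (K * q ^ k) * (‖coeff (n - k) f * ρ ^ (n - k)‖ *
            √(((n - k + 1 : ℕ) : ℝ) ^ 3)) * √(((k + 1 : ℕ) : ℝ) ^ 3) := by ring
        _ ≤ (K * q ^ k) * D * √(((k + 1 : ℕ) : ℝ) ^ 3) := by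
            gcongr; exact hD _
        _ = _ := by ring
    · rw [norm_zero]
      positivity

/-- Division by a linear factor whose root lies inside the disc of convergence, and is cancelled
by the numerator. -/
theorem HasTail.of_mul_linear {f g : ℝ⟦X⟧} {ρ c l : ℝ} (hρ : 0 < ρ) (hl : 1 < l * ρ)
    (h : (1 - C l * X) * f = g) (hg : HasTail g ρ c) (h0 : EvalsTo g l⁻¹ 0) :
    HasTail f ρ (-(c / (l * ρ - 1))) := by
  have hl0 : 0 < l := pos_of_mul_pos_left (one_pos.trans hl) hρ.le
  have hpart : ∀ n, ∑ i ∈ Finset.range (n + 1), coeff i g * l⁻¹ ^ i = coeff n f * l⁻¹ ^ n := by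
    have e : g = f - C l * (X * f) := by rw [← h]; ring
    intro n
    induction n with
    | zero => simp [e]
    | succ n ih =>
      rw [Finset.sum_range_succ, ih, e, map_sub, coeff_C_mul, coeff_succ_X_mul, pow_succ]
      field_simp
      ring
  -- The coefficients of f are scaled partial sums of g(1/l) = 0, hence minus the remainders, which
  -- inherit the decay of g.
  have htail : ∀ n, HasSum (fun j => coeff (j + (n + 1)) g * l⁻¹ ^ (j + (n + 1)))
      (-(coeff n f * l⁻¹ ^ n)) := fun n => by
    have := (hasSum_nat_add_iff' (n + 1)).2 h0.2
    rwa [hpart, zero_sub] at this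
  let G : ℕ → ℕ → ℝ := fun n j => coeff (j + (n + 1)) g * ρ ^ (j + (n + 1)) *
    √((n : ℝ) ^ 3) * ((l * ρ)⁻¹ ^ (j + 1))
  have hG : ∀ n, coeff n f * ρ ^ n * √((n : ℝ) ^ 3) = ∑' j, -(G n j) := fun n => by
    have := ((htail n).mul_right (-(l ^ n * ρ ^ n * √((n : ℝ) ^ 3)))).tsum_eq
    rw [show coeff n f * ρ ^ n * √((n : ℝ) ^ 3) =
      -(coeff n f * l⁻¹ ^ n) * -(l ^ n * ρ ^ n * √((n : ℝ) ^ 3)) by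
        rw [inv_pow]; field_simp, ← this]
    refine tsum_congr fun j => ?_
    simp only [G]
    rw [show j + (n + 1) = (j + 1) + n by ring, pow_add l⁻¹ (j + 1) n, pow_add ρ (j + 1) n, inv_pow,
      inv_pow, inv_pow, mul_pow]
    field_simp
  obtain ⟨D, hD0, hD⟩ := hg.exists_bound
  have hr0 : 0 ≤ (l * ρ)⁻¹ := by positivity
  have hr1 : (l * ρ)⁻¹ < 1 := inv_lt_one_of_one_lt₀ hl
  have hc : -(c / (l * ρ - 1)) = ∑' j : ℕ, -(c * (l * ρ)⁻¹ ^ (j + 1)) := by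
    simp_rw [pow_succ]
    rw [tsum_neg, tsum_mul_left, tsum_mul_right, tsum_geometric_of_lt_one hr0 hr1]
    have : l * ρ - 1 ≠ 0 := by linarith
    field_simp
  unfold HasTail
  simp_rw [hG]
  rw [hc]
  refine tendsto_tsum_of_dominated_convergence (bound := fun j => D * (l * ρ)⁻¹ ^ (j + 1))
    (((summable_geometric_of_lt_one hr0 hr1).comp_injective (add_left_injective 1)).mul_left D)
    (fun j => ?_) (Eventually.of_forall fun n j => ?_)
  · refine Tendsto.neg (Tendsto.mul_const _ ?_)
    have h := (hg.comp (tendsto_add_atTop_nat (j + 1))).mul (tendsto_sqrt_cube_div (j + 1))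
    rw [mul_one] at h
    refine h.congr fun n => ?_
    have h2 : √(((n + (j + 1) : ℕ) : ℝ) ^ 3) ≠ 0 := by positivity
    simp only [Function.comp]
    rw [show j + (n + 1) = n + (j + 1) by ring]
    field_simp
  · simp only [G]
    rw [norm_neg, norm_mul, norm_mul, Real.norm_of_nonneg (Real.sqrt_nonneg _),
      Real.norm_of_nonneg (pow_nonneg hr0 _)]
    gcongr
    refine le_trans ?_ (hD (j + (n + 1)))
    rw [norm_mul _ √_, Real.norm_of_nonneg (Real.sqrt_nonneg _)]
    gcongr
    omega

/-- The tail depends only on the coefficients of large index. -/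
theorem HasTail.congr_eventually {f g : ℝ⟦X⟧} {ρ c : ℝ} (hf : HasTail f ρ c)
    (h : ∀ᶠ n in atTop, coeff n f = coeff n g) : HasTail g ρ c :=
  Tendsto.congr' (h.mono fun n hn => by rw [hn]) hf

/-! ### The model singularity √(1 - x/ρ) -/

/-- For n > 0 the expression equals `stirlingSeq (2 * n) / stirlingSeq n ^ 2`, which tends to √π/π
by Stirling's formula. -/
theorem tendsto_centralBinom_mul_sqrt :
    Tendsto (fun n : ℕ => (n.centralBinom : ℝ) / 4 ^ n * √n) atTop (𝓝 (√Real.pi)⁻¹) := by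
  have hpi : √Real.pi ≠ 0 := by positivity
  have h1 := Stirling.tendsto_stirlingSeq_sqrt_pi
  have h2 := (h1.comp (tendsto_id.const_mul_atTop' (show 0 < 2 by norm_num))).div (h1.pow 2)
    (pow_ne_zero 2 hpi)
  rw [show √Real.pi / √Real.pi ^ 2 = (√Real.pi)⁻¹ by field_simp] at h2
  refine h2.congr' ?_
  filter_upwards [eventually_gt_atTop 0] with n hn
  have hn' : (0 : ℝ) < n := by exact_mod_cast hn
  have hc : (n.centralBinom : ℝ) * ((n.factorial : ℝ) * n.factorial) = (2 * n).factorial := by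
    have := Nat.choose_mul_factorial_mul_factorial (show n ≤ 2 * n by omega)
    rw [show 2 * n - n = n by omega, ← Nat.centralBinom_eq_two_mul_choose] at this
    rw [← mul_assoc]
    exact_mod_cast this
  simp only [Pi.div_apply, Function.comp, id, Stirling.stirlingSeq]
  rw [← hc]
  have e1 : √(2 * ((2 * n : ℕ) : ℝ)) = 2 * √n := by
    rw [show 2 * ((2 * n : ℕ) : ℝ) = 2 ^ 2 * n by push_cast; ring,
      Real.sqrt_mul (by norm_num), Real.sqrt_sq (by norm_num)]
  have e2 : √(2 * (n : ℝ)) ^ 2 = 2 * (√n * √n) := by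
    rw [Real.sq_sqrt (by positivity), Real.mul_self_sqrt hn'.le]
  have e3 : (((2 * n : ℕ) : ℝ) / Real.exp 1) ^ (2 * n) = 4 ^ n * ((n : ℝ) / Real.exp 1) ^ (2 * n) := by
    rw [show ((2 * n : ℕ) : ℝ) / Real.exp 1 = 2 * (n / Real.exp 1) by push_cast; ring, mul_pow,
      pow_mul]
    norm_num
  have hs : √(n : ℝ) ≠ 0 := by positivity
  have hf : (n.factorial : ℝ) ≠ 0 := by positivity
  have hE : (n : ℝ) / Real.exp 1 ≠ 0 := by positivity
  rw [div_pow _ _ 2, mul_pow √(2 * (n : ℝ)), e1, e2, e3, ← pow_mul, mul_comm n 2]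
  field_simp

/-- The power series of `√(1 - x / ρ)`, in terms of Catalan numbers. -/
theorem exists_sqrt_one_sub_series {ρ : ℝ} (hρ : 0 < ρ) : ∃ B : ℝ⟦X⟧,
    coeff 0 B = 1 ∧ B ^ 2 = 1 - C ρ⁻¹ * X ∧ HasTail B ρ (-(2 * √Real.pi)⁻¹) := by
  set S : ℝ⟦X⟧ := rescale (4 * ρ)⁻¹ (map (Nat.castRingHom ℝ) catalanSeries) with hS
  have hSe : S ^ 2 * (C (4 * ρ)⁻¹ * X) + 1 = S := by
    have := congrArg (fun f => rescale (4 * ρ)⁻¹ (map (Nat.castRingHom ℝ) f))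
      catalanSeries_sq_mul_X_add_one
    simpa [rescale_X, ← hS, -mul_inv_rev] using this
  have hC : (2 : ℝ⟦X⟧) * C (4 * ρ)⁻¹ = C (2 * ρ)⁻¹ := by
    rw [show (2 : ℝ⟦X⟧) = C 2 from (map_ofNat C 2).symm, ← map_mul]
    congr 1
    field_simp
    norm_num
  have hC' : (4 : ℝ⟦X⟧) * C (4 * ρ)⁻¹ = C ρ⁻¹ := by
    rw [show (4 : ℝ⟦X⟧) = C 4 from (map_ofNat C 4).symm, ← map_mul]
    congr 1
    field_simp
  -- The Catalan series c(z) satisfies √(1 - 4z) = 1 - 2z c(z); here z = x/(4ρ).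
  refine ⟨1 - C (2 * ρ)⁻¹ * (X * S), by simp, ?_, ?_⟩
  · rw [← hC, ← hC']
    linear_combination (4 * C (4 * ρ)⁻¹ * X) * hSe
  · unfold HasTail
    rw [← tendsto_add_atTop_iff_nat 1]
    have h1 : Tendsto (fun n : ℕ => √(((n : ℝ) + 1) / n)) atTop (𝓝 1) := by
      have h := ((tendsto_natCast_div_add_atTop (𝕜 := ℝ) 1).inv₀ one_ne_zero).sqrt
      simpa using h
    have h2 := (tendsto_centralBinom_mul_sqrt.mul h1).const_mul (-(1 / 2 : ℝ))
    rw [show -(1 / 2) * ((√Real.pi)⁻¹ * 1) = -(2 * √Real.pi)⁻¹ by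
      rw [mul_inv]; ring] at h2
    refine h2.congr' ?_
    filter_upwards [eventually_gt_atTop 0] with n hn
    have hn' : (0 : ℝ) < n := by exact_mod_cast hn
    have hcat : (n.centralBinom : ℝ) = (n + 1) * catalan n := by
      exact_mod_cast (succ_mul_catalan_eq_centralBinom n).symm
    have e1 : √(((n + 1 : ℕ) : ℝ) ^ 3) = (n + 1) * √((n : ℝ) + 1) := by
      rw [show (((n + 1 : ℕ) : ℝ) ^ 3) = ((n : ℝ) + 1) ^ 2 * (n + 1) by push_cast; ring,
        Real.sqrt_mul (by positivity), Real.sqrt_sq (by positivity)]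
    have e2 : coeff (n + 1) (1 - C (2 * ρ)⁻¹ * (X * S)) =
        -((2 * ρ)⁻¹ * ((4 * ρ)⁻¹ ^ n * catalan n)) := by
      rw [map_sub, coeff_one, if_neg n.succ_ne_zero, coeff_C_mul, coeff_succ_X_mul, hS,
        coeff_rescale, coeff_map, catalanSeries_coeff, zero_sub]
      rfl
    rw [e2, e1, hcat, Real.sqrt_div (by positivity), inv_pow, mul_pow, pow_succ]
    have hs : √(n : ℝ) ≠ 0 := by positivity
    field_simp

theorem EvalsTo.sum_range_le {f : ℝ⟦X⟧} {x y : ℝ} (hf : EvalsTo f x y) (hx : 0 ≤ x)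
    (h : ∀ n, 0 ≤ coeff n f) (n : ℕ) : ∑ k ∈ Finset.range n, coeff k f * x ^ k ≤ y :=
  sum_le_hasSum _ (fun k _ => mul_nonneg (h k) (pow_nonneg hx k)) hf.2

/-- Taking radius 1 makes the terms at ρ < 1 at most ρⁿ, the geometric decay that `HasTail.mul`
needs. -/
theorem norm_coeff_sqrt_series_le {f p : ℝ⟦X⟧} (hf : f ^ 2 = 1 - p)
    (hf0 : coeff 0 f = 1) (hp : ∀ n, 0 ≤ coeff n p)
    (hp1 : ∀ n, ∑ k ∈ Finset.range n, coeff k p * 1 ^ k ≤ 1) (n : ℕ) : ‖coeff n f‖ ≤ 1 := by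
  obtain ⟨hpos, hsum⟩ := sqrt_series_bounds zero_le_one hf hf0 hp hp1
  rcases Nat.eq_zero_or_pos n with rfl | hn
  · simp [hf0]
  have h1 : coeff n (1 - f) ≤ 1 := by
    refine le_trans ?_ (hsum (n + 1))
    have := Finset.single_le_sum (f := fun k => coeff k (1 - f) * (1 : ℝ) ^ k)
      (fun k _ => mul_nonneg (hpos k) (pow_nonneg zero_le_one k)) (Finset.self_mem_range_succ n)
    simpa using this
  have h2 : coeff n (1 - f) = -coeff n f := by
    rw [map_sub, coeff_one, if_neg hn.ne', zero_sub]
  have h3 := hpos n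
  rw [h2] at h1 h3
  rw [Real.norm_eq_abs, abs_le]
  constructor <;> linarith

theorem one_sub_mul_geometric (m : ℝ) :
    (1 - C m * X) * (PowerSeries.mk fun n => m ^ n) = 1 := by
  ext n
  rw [sub_mul, one_mul, map_sub, coeff_mk, mul_assoc, coeff_C_mul]
  cases n with
  | zero => simp
  | succ n => rw [coeff_succ_X_mul, coeff_mk, coeff_one, if_neg n.succ_ne_zero, pow_succ]; ring

/-! ### The dominant singularity and the asymptotics -/

theorem exists_root_cubic : ∃ ρ : ℝ, |ρ - 0.295598| < 0.0000005 ∧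
    1 - 3 * ρ - ρ ^ 2 - ρ ^ 3 = 0 := by
  have hc : ContinuousOn (fun x : ℝ => 1 - 3 * x - x ^ 2 - x ^ 3)
      (Set.Icc 0.2955976 0.2955984) := by fun_prop
  obtain ⟨ρ, hρ, h⟩ := intermediate_value_Icc' (by norm_num) hc
    (show (0 : ℝ) ∈ Set.Icc _ _ by constructor <;> norm_num)
  refine ⟨ρ, ?_, h⟩
  rw [abs_lt]
  constructor <;> linarith [hρ.1, hρ.2]

/-- The quartic is (1 - x)(1 - 3x - x² - x³), and the cubic factor is strictly decreasing for x > 0.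
-/
theorem isLeast_of_root_cubic {ρ : ℝ} (h0 : 0 < ρ) (h1 : ρ < 1)
    (h : 1 - 3 * ρ - ρ ^ 2 - ρ ^ 3 = 0) :
    IsLeast {x : ℝ | 0 < x ∧ 1 - 4 * x + 2 * x ^ 2 + x ^ 4 = 0} ρ := by
  refine ⟨⟨h0, by linear_combination (1 - ρ) * h⟩, fun x ⟨hx0, hx⟩ => ?_⟩
  by_contra! hlt
  have h2 : (1 - x) * (1 - 3 * x - x ^ 2 - x ^ 3) = 0 := by linear_combination hx
  have h3 : 1 - 3 * x - x ^ 2 - x ^ 3 = 0 := (mul_eq_zero.1 h2).resolve_left (by linarith)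
  have h4 : x ^ 2 ≤ ρ ^ 2 := by gcongr
  have h5 : x ^ 3 ≤ ρ ^ 3 := by gcongr
  linarith

/-- The square root of `1 - 4X + 2X² + X⁴` has a tail governed by its singularity at `ρ`, and
takes the value `√(1 - 4x + 2x² + x⁴)` inside its disc of convergence. -/
theorem sqrt_series_tail {ρ : ℝ} (h0 : 0 < ρ) (h1 : ρ < 1 / 2)
    (h : 1 - 3 * ρ - ρ ^ 2 - ρ ^ 3 = 0) {N : ℝ⟦X⟧} (hN0 : coeff 0 N = 1)
    (hN : N ^ 2 = 1 - 4 * X + 2 * X ^ 2 + X ^ 4) :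
    HasTail N ρ (-(2 * √Real.pi)⁻¹ * √(ρ * (4 - 4 * ρ - 4 * ρ ^ 3))) ∧
      ∀ x, 0 ≤ x → x ≤ ρ → EvalsTo N x √(1 - 4 * x + 2 * x ^ 2 + x ^ 4) := by
  obtain ⟨B, hB0, hB, hBt⟩ := exists_sqrt_one_sub_series h0
  have hinv : ρ⁻¹ = 3 + ρ + ρ ^ 2 := by
    field_simp
    linear_combination h
  -- 1 - p is the quotient of 1 - 4X + 2X² + X⁴ by 1 - X/ρ, reduced by the cubic equation for ρ;
  -- p(1) = 1 reflects the root 1 of the quartic.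
  set p : ℝ⟦X⟧ := C (1 - ρ - ρ ^ 2) * X + C (ρ ^ 2) * X ^ 2 + C ρ * X ^ 3 with hp
  set s := N * B⁻¹ with hs
  have hBc : constantCoeff B ≠ 0 := by
    rw [← coeff_zero_eq_constantCoeff_apply, hB0]; exact one_ne_zero
  have hsB : B * s = N := by
    rw [hs, mul_comm N, ← mul_assoc, PowerSeries.mul_inv_cancel B hBc, one_mul]
  have hs0 : coeff 0 s = 1 := by
    have := congrArg constantCoeff hsB
    simpa only [map_mul, ← coeff_zero_eq_constantCoeff_apply, hB0, hN0, one_mul] using this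
  have hs2 : s ^ 2 = 1 - p := by
    have hB2 : B ^ 2 ≠ 0 := pow_ne_zero 2 fun hz => hBc (by simp [hz])
    refine mul_left_cancel₀ hB2 ?_
    rw [← mul_pow, hsB, hN, hB, hp, hinv]
    have hC := congrArg (C : ℝ → ℝ⟦X⟧) h
    simp only [map_sub, map_one, map_mul, map_pow, map_zero, map_ofNat] at hC
    simp only [map_sub, map_add, map_one, map_pow, map_ofNat]
    linear_combination (-(1 + C ρ) * X ^ 2 + C ρ * X ^ 3 + X ^ 4) * hC
  have hpe : ∀ x, EvalsTo p x ((1 - ρ - ρ ^ 2) * x + ρ ^ 2 * x ^ 2 + ρ * x ^ 3) := fun x =>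
    (((EvalsTo.const _).mul .var).add ((EvalsTo.const _).mul (EvalsTo.var.pow 2))).add
      ((EvalsTo.const _).mul (EvalsTo.var.pow 3))
  have hpn : ∀ n, 0 ≤ coeff n p := fun n => by
    have : 0 ≤ 1 - ρ - ρ ^ 2 := by nlinarith
    rw [hp, map_add, map_add, coeff_C_mul, coeff_C_mul, coeff_C_mul, coeff_X, coeff_X_pow,
      coeff_X_pow]
    positivity
  have hp1 : ∀ n, ∑ k ∈ Finset.range n, coeff k p * (1 : ℝ) ^ k ≤ 1 := fun n =>
    ((hpe 1).sum_range_le zero_le_one hpn n).trans (by linarith)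
  have hse : ∀ x, 0 ≤ x → x ≤ 1 →
      EvalsTo s x √(1 - ((1 - ρ - ρ ^ 2) * x + ρ ^ 2 * x ^ 2 + ρ * x ^ 3)) := fun x hx hx1 =>
    sqrt_series_evalsTo zero_le_one hs2 hs0 hpn hp1 hx hx1 (EvalsTo.one.sub (hpe x))
  have hqe : ∀ x, EvalsTo (C ρ⁻¹ * X : ℝ⟦X⟧) x (ρ⁻¹ * x) := fun x => (EvalsTo.const _).mul .var
  have hqn : ∀ n, 0 ≤ coeff n (C ρ⁻¹ * X : ℝ⟦X⟧) := fun n => by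
    rw [coeff_C_mul, coeff_X]
    positivity
  have hBe : ∀ x, 0 ≤ x → x ≤ ρ → EvalsTo B x √(1 - ρ⁻¹ * x) := fun x hx hx1 =>
    sqrt_series_evalsTo h0.le hB hB0 hqn
      (fun n => ((hqe ρ).sum_range_le h0.le hqn n).trans (inv_mul_cancel₀ h0.ne').le) hx hx1
      (EvalsTo.one.sub (hqe x))
  constructor
  · rw [← hsB]
    have e : ρ * (4 - 4 * ρ - 4 * ρ ^ 3) =
        1 - ((1 - ρ - ρ ^ 2) * ρ + ρ ^ 2 * ρ ^ 2 + ρ * ρ ^ 3) := by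
      linear_combination (-1 + 2 * ρ) * h
    rw [e]
    refine hBt.mul h0.le (by linarith) (K := 1) (fun n => ?_) (hse ρ h0.le (by linarith))
    rw [norm_mul, norm_pow, Real.norm_of_nonneg h0.le]
    gcongr
    exact norm_coeff_sqrt_series_le hs2 hs0 hpn hp1 n
  · intro x hx hxρ
    have hmul := (hBe x hx hxρ).mul (hse x hx (by linarith))
    have hnn : 0 ≤ 1 - ρ⁻¹ * x := by
      rw [sub_nonneg, inv_mul_le_iff₀ h0]
      linarith
    rw [hsB, ← Real.sqrt_mul hnn] at hmul
    convert hmul using 2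
    rw [hinv]
    linear_combination (-(1 + ρ) * x ^ 2 + ρ * x ^ 3 + x ^ 4) * h

theorem hasTail_restricted {ρ : ℝ} (h0 : 0.295 < ρ) (h1 : ρ < 1 / 2)
    (h : 1 - 3 * ρ - ρ ^ 2 - ρ ^ 3 = 0) :
    HasTail (PowerSeries.mk fun n => (numRestricted (-1) n : ℝ)) ρ
      ((√Real.pi)⁻¹ * (√(ρ * (4 - 4 * ρ - 4 * ρ ^ 3)) / (4 * (-1 + 4 * ρ - 2 * ρ ^ 2)))) := by
  obtain ⟨N, hN0, hN2, hR⟩ := exists_sqrt_series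
  have hρ : 0 < ρ := by linarith
  obtain ⟨hNt, hNe⟩ := sqrt_series_tail hρ h1 h hN0 hN2
  set R : ℝ⟦X⟧ := PowerSeries.mk fun n => (numRestricted (-1) n : ℝ)
  have hsq : √2 * √2 = (2 : ℝ) := Real.mul_self_sqrt (by norm_num)
  have hs1 : 1.414 < √2 := Real.lt_sqrt_of_sq_lt (by norm_num)
  have hs2 : √2 < 2 := by nlinarith
  set l := 2 + √2 with hl
  set m := 2 - √2 with hm
  have hlm : l * m = 2 := by rw [hl, hm]; linear_combination -hsq
  have hsum : l + m = 4 := by rw [hl, hm]; ring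
  have hm0 : 0 < m := by rw [hm]; linarith
  -- A narrow margin: 1/l ≈ 0.2929 lies just below ρ, which is why the bound 0.295 < ρ is needed.
  have hlρ : 1 < l * ρ := by nlinarith
  have hmρ : m * ρ < 1 := by nlinarith
  have hinv : l⁻¹ = m / 2 := by
    rw [inv_eq_iff_eq_inv, inv_div, eq_div_iff hm0.ne', hlm]
  have hfac : (1 - C l * X) * ((1 - C m * X) * (2 * R)) =
      1 - 4 * X + X ^ 2 + N := by
    have e1 : (C l : ℝ⟦X⟧) * C m = 2 := by rw [← map_mul, hlm, map_ofNat]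
    have e2 : (C l : ℝ⟦X⟧) + C m = 4 := by rw [← map_add, hsum, map_ofNat]
    rw [← hR]
    linear_combination (2 * R * X ^ 2) * e1 - (2 * R * X) * e2
  have hMt : HasTail (1 - 4 * X + X ^ 2 + N) ρ _ := hNt.congr_eventually (by
    filter_upwards [eventually_gt_atTop 2] with n hn
    rw [map_add, map_add, map_sub, coeff_one, coeff_X_pow, ← map_ofNat (C : ℝ →+* ℝ⟦X⟧) 4,
      coeff_C_mul, coeff_X, if_neg (by omega), if_neg (by omega), if_neg (by omega)]
    simp)
  have hMe : EvalsTo (1 - 4 * X + X ^ 2 + N) l⁻¹ 0 := by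
    have hle : l⁻¹ ≤ ρ := by
      rw [inv_le_iff_one_le_mul₀' (by linarith)]
      exact hlρ.le
    have hp : 0 ≤ l⁻¹ := by rw [hinv]; positivity
    have := (((EvalsTo.one (x := l⁻¹)).sub ((EvalsTo.const 4).mul .var)).add
      (EvalsTo.var.pow 2)).add (hNe _ hp hle)
    -- At x = 1/l the radicand is therefore x⁴, so N(x) = x², while 1 - 4x + x² = -x²: the numerator
    -- vanishes.
    have hq : 1 - 4 * l⁻¹ + 2 * l⁻¹ ^ 2 = 0 := by
      rw [hinv, hm]
      linear_combination hsq / 2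
    rw [hq, zero_add, show l⁻¹ ^ 4 = (l⁻¹ ^ 2) ^ 2 by ring, Real.sqrt_sq (by positivity),
      map_ofNat] at this
    convert this using 1
    linear_combination -hq
  have hE := HasTail.of_mul_linear hρ hlρ hfac hMt hMe
  have hge : EvalsTo (PowerSeries.mk fun n => m ^ n) ρ (1 - m * ρ)⁻¹ := by
    have e : (fun n => coeff n (PowerSeries.mk fun n => m ^ n) * ρ ^ n) =
        fun n => (m * ρ) ^ n := by ext n; rw [coeff_mk, mul_pow]
    have hsm := hasSum_geometric_of_lt_one (by positivity) hmρ
    rw [← e] at hsm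
    exact ⟨hsm.summable.norm, hsm⟩
  have hRt := hE.mul (K := 1) (by positivity) hmρ (fun n => by
    rw [coeff_mk, ← mul_pow, one_mul, Real.norm_of_nonneg (by positivity)]) hge
  rw [show (1 - C m * X) * (2 * R) * (PowerSeries.mk fun n => m ^ n) = 2 * R by
    linear_combination (2 * R) * one_sub_mul_geometric m] at hRt
  have hfin := Filter.Tendsto.const_mul (1 / 2) hRt
  have hden : (l * ρ - 1) * (1 - m * ρ) = -1 + 4 * ρ - 2 * ρ ^ 2 := by
    linear_combination ρ * hsum - ρ ^ 2 * hlm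
  unfold HasTail
  convert hfin using 2 with n
  · rw [← map_ofNat (C : ℝ →+* ℝ⟦X⟧) 2, coeff_C_mul]
    ring
  · rw [← hden]
    have : l * ρ - 1 ≠ 0 := by linarith
    have : 1 - m * ρ ≠ 0 := by linarith
    have : √Real.pi ≠ 0 := by positivity
    field_simp
    ring

theorem theorem3p5 :
    ∃ ρ : ℝ,
      IsLeast {x : ℝ | 0 < x ∧ 1 - 4 * x + 2 * x ^ 2 + x ^ 4 = 0} ρ ∧
      |ρ - 0.295598| < 0.0000005 ∧
      (fun n : ℕ => (numRestricted (-1) n : ℝ)) ~[atTop]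
        (fun n : ℕ => ρ ^ (-(n : ℤ)) / √(Real.pi * (n : ℝ) ^ 3) *
          (√(ρ * (4 - 4 * ρ - 4 * ρ ^ 3)) / (4 * (-1 + 4 * ρ - 2 * ρ ^ 2)))) := by
  obtain ⟨ρ, hρ, h⟩ := exists_root_cubic
  have hb := abs_lt.1 hρ
  have h0 : 0.295 < ρ := by linarith
  have h1 : ρ < 0.296 := by linarith
  have hpos : 0 < ρ := by linarith
  refine ⟨ρ, isLeast_of_root_cubic hpos (by linarith) h, hρ, ?_⟩
  have ht := hasTail_restricted h0 (by linarith) h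
  set c := √(ρ * (4 - 4 * ρ - 4 * ρ ^ 3)) / (4 * (-1 + 4 * ρ - 2 * ρ ^ 2)) with hc
  have hc0 : 0 < c := by
    have h2 : 0 < ρ * (4 - 4 * ρ - 4 * ρ ^ 3) := mul_pos hpos (by nlinarith)
    have h3 : 0 < -1 + 4 * ρ - 2 * ρ ^ 2 := by
      -- This is the quartic equation for ρ, and it makes the denominator visibly positive.
      rw [show -1 + 4 * ρ - 2 * ρ ^ 2 = ρ ^ 4 by linear_combination -(1 - ρ) * h]
      positivity
    exact div_pos (Real.sqrt_pos.2 h2) (by linarith)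
  have hpi : 0 < √Real.pi := by positivity
  have hlim := Filter.Tendsto.div_const ht ((√Real.pi)⁻¹ * c)
  rw [div_self (by positivity)] at hlim
  refine isEquivalent_of_tendsto_one (hlim.congr' ?_)
  filter_upwards [eventually_gt_atTop 0] with n hn
  have hn' : √((n : ℝ) ^ 3) ≠ 0 := by positivity
  rw [Pi.div_apply, coeff_mk, Real.sqrt_mul Real.pi_pos.le, zpow_neg, zpow_natCast]
  field_simp
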